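/- \textbf{Theorem.} Let $[m]=\{1,\dots,m\}$. For a finite group $G$ with identity $e$, a subgroup $H\le G^m$ and $h\in H$, let $\operatorname{Ham}(h)$ be the number of $i\in[m]$ with $h_i\ne e$, and for $w:[m]\to\mathbb{R}_{\ge 0}$ let $\langle w,h\rangle:=\sum_{i:\,h_i\neq e}w(i)$. For $\varepsilon\in(0,1)$, a function $v:[m]\to\mathbb{R}_{\ge0}$ is an \emph{$\varepsilon$-sparsifier} of $H$ if $(1-\varepsilon)\operatorname{Ham}(h)\le\langle v,h\rangle\le(1+\varepsilon)\operatorname{Ham}(h)$ for all $h\in H$, and a \emph{$(w,\varepsilon)$-sparsifier} of $H$ if $(1-\varepsilon)\langle w,h\rangle\le\langle v,h\rangle\le(1+\varepsilon)\langle w,h\rangle$ for all $h\in H$; its \emph{size} is the number of $i\in[m]$ with $v(i)\neq0$. Let $C_H:=\{(\mathbf 1[h_i\neq e])_{i\in[m]}:h\in H\}\subseteq\{0,1\}^m$. For a code $C\subseteq\{0,1\}^m$, let $\operatorname{NRD}(C)$ be the largest size of a set $I\subseteq[m]$ such that for every $i\in I$ there is $c\in C$ such that for all $j\in I$, $c_{j}=1$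 if and only if $j=i$; and let $\operatorname{CL}(C)$ be the largest $\ell \ge 0$ for which there are injective maps $a:[\ell]\to[m]$ and $c:[\ell]\to C$ with $c(i)_{a(i)}=1$ for all $i\in[\ell]$ and $c(j)_{a(i)}=0$ for all $1\le i<j\le\ell$. There is an absolute constant $K>0$ such that for every finite (possibly non-Abelian) group $G$, every $m\ge0$ and every subgroup $H\le G^m$: (1) $\operatorname{NRD}(C_H)\le\log_2|H|$ and $\operatorname{CL}(C_H)\le\log_2|H|$; (2) for every $\varepsilon\in(0,1)$, $H$ has an $\varepsilon$-sparsifier of size at most $K\log|H|\,(\log\max(m,2))^6/\varepsilon^2$; (3) for every $\varepsilon\in(0,1)$ and every weight function $w:[m]\to\mathbb{R}_{\ge0}$, $H$ has a $(w,\varepsilon)$-sparsifier of size at most $K\log|H|\,(\log\max(m,2))^6/\varepsilon^2$. -/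

import Mathlib

open scoped NNReal

/-- A set `I` of coordinates is non-redundant for the code `C ⊆ {0,1}^ι` if for each `i ∈ I` some
codeword has a `1` in position `i` and a `0` in every other position of `I`. -/
def IsNonRedundant {ι : Type*} (C : Set (ι → Bool)) (I : Finset ι) : Prop :=
  ∀ i ∈ I, ∃ c ∈ C, ∀ j ∈ I, (c j = true ↔ i = j)

/-- The non-redundancy of a code: the size of its largest non-redundant set of coordinates. (The set
of sizes contains `0` and is bounded by the number of coordinates.) -/
noncomputable def nonRedundancy {ι : Type*} [Fintype ι] (C : Set (ι → Bool)) : ℕ :=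
  sSup {k : ℕ | ∃ I : Finset ι, IsNonRedundant C I ∧ I.card = k}

/-- A chain of length `l` in the code `C`: coordinates `a` and codewords `c`, both injectively
indexed, with `c(i)_{a(i)} = 1` for all `i` and `c(j)_{a(i)} = 0` for all `i < j`. -/
structure IsCodeChain {ι : Type*} (C : Set (ι → Bool)) {l : ℕ} (a : Fin l → ι)
    (c : Fin l → ι → Bool) : Prop where
  injective_index : Function.Injective a
  injective_word : Function.Injective c
  mem : ∀ i, c i ∈ C
  diag : ∀ i, c i (a i) = true
  above : ∀ i j, i < j → c j (a i) = false

/-- The chain length of a code: the length of its longest chain. (The set of lengths contains `0`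
and is bounded by the number of coordinates.) -/
noncomputable def chainLength {ι : Type*} [Fintype ι] (C : Set (ι → Bool)) : ℕ :=
  sSup {l : ℕ | ∃ (a : Fin l → ι) (c : Fin l → ι → Bool), IsCodeChain C a c}

/-- The zero pattern code of `H ≤ G^ι`: all words `(1[h_i ≠ e])_i` for `h ∈ H`. -/
def zeroPatternCode {ι G : Type*} [Group G] (H : Subgroup (ι → G)) : Set (ι → Bool) :=
  {c | ∃ h ∈ H, ∀ i, (c i = true ↔ h i ≠ 1)}

/-- The Hamming weight of `h ∈ G^ι`: the number of its non-identity coordinates. -/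
noncomputable def groupHamming {ι G : Type*} [Group G] (h : ι → G) : ℕ :=
  {i | h i ≠ 1}.ncard

/-- The `w`-weight of `h ∈ G^ι`: the sum of the weights of its non-identity coordinates. -/
noncomputable def groupWeight {ι G : Type*} [Fintype ι] [Group G] (w : ι → ℝ≥0) (h : ι → G) : ℝ :=
  ∑ i, Set.indicator {i | h i ≠ 1} (fun i => (w i : ℝ)) i

/-- `v` is an `ε`-sparsifier of `H`: the `v`-weight of every `h ∈ H` is within a factor `1 ± ε` of
its Hamming weight. -/
def IsGroupSparsifier {ι G : Type*} [Fintype ι] [Group G] (H : Subgroup (ι → G)) (ε : ℝ)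
    (v : ι → ℝ≥0) : Prop :=
  ∀ h ∈ H, (1 - ε) * (groupHamming h : ℝ) ≤ groupWeight v h ∧
    groupWeight v h ≤ (1 + ε) * (groupHamming h : ℝ)

/-- `v` is a `(w, ε)`-sparsifier of `H`: the `v`-weight of every `h ∈ H` is within a factor `1 ± ε`
of its `w`-weight. -/
def IsWeightedGroupSparsifier {ι G : Type*} [Fintype ι] [Group G] (H : Subgroup (ι → G))
    (w : ι → ℝ≥0) (ε : ℝ) (v : ι → ℝ≥0) : Prop :=
  ∀ h ∈ H, (1 - ε) * groupWeight w h ≤ groupWeight v h ∧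
    groupWeight v h ≤ (1 + ε) * groupWeight w h

/-- The size of a sparsifier: the number of coordinates of nonzero weight. -/
noncomputable def sparsifierSize {ι : Type*} (v : ι → ℝ≥0) : ℕ :=
  (Function.support v).ncard

/-! A chain in the zero pattern code yields a strictly descending series of subgroups of `H`, each
forced to be trivial at one more coordinate. A proper subgroup has at most half the elements, so the
length is at most `log₂ |H|`. A non-redundant set is a chain in any order.

The sparsifiers come from importance sampling. The logarithm of the size of the projection of `H` to
a set of coordinates is a monotone submodular rank, even for non-Abelian `G`, since submodularity
only compares numbers of cosets. `exists_importance` splits the weights by density as `w = (w / u) *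
u`, where `u` has total at most `log₂ |H|`, so that for the projection of `H` to any upper level set
of `w / u`, each subgroup `Q` satisfies `log₂ |Q| ≤ u(supp Q)`. This is the hypothesis of a
contraction argument in the style of Karger's cut counting (`ncard_light_le`): only polynomially
many elements, to the power `n`, have `u`-weight at most `n`.

Keep coordinate `i` with probability `min 1 (C * u i)`, where `C` is of order `log M / ε²` and `M =
max m 2`. A Chernoff bound beats this count, so one outcome preserves the `u`-weights of the
supports in all of the at most `m` relevant levels (`exists_sparse_reweighting`), while about `C *
log |H|` coordinates survive. Integrating over the levels of `w / u` turns this into preservation of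
`w`-weights. The argument needs only one factor `log M`. -/

/-! ### Level sets and density decomposition -/

/-- Layer cake principle: if `g` has nonnegative sum over every upper level set of the nonnegative
function `f`, then `f * g` has nonnegative sum. -/
theorem sum_mul_nonneg_of_upper_level_sums {ι : Type*} (s : Finset ι) (f g : ι → ℝ)
    (hf : ∀ i ∈ s, 0 ≤ f i)
    (hg : ∀ j ∈ s, 0 ≤ ∑ i ∈ s with f j ≤ f i, g i) : 0 ≤ ∑ i ∈ s, f i * g i := by
  induction s using Finset.strongInduction generalizing f with
  | H s ih =>
    rcases s.eq_empty_or_nonempty with rfl | hs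
    · simp
    -- Peel off the bottom layer: `f = f a + (f - f a)`. The remainder lives on the strict upper
    -- level set, and its upper level sets are again those of `f`.
    obtain ⟨a, ha, hmin⟩ := s.exists_min_image f hs
    have hall : (s.filter fun i => f a ≤ f i) = s := Finset.filter_true_of_mem hmin
    have htot : 0 ≤ ∑ i ∈ s, g i := by simpa only [hall] using hg a ha
    have hsub : (s.filter fun i => f a < f i) ⊂ s :=
      Finset.filter_ssubset.2 ⟨a, ha, lt_irrefl _⟩
    have hrec := ih _ hsub (fun i => f i - f a)
      (fun i hi => sub_nonneg.2 (Finset.mem_filter.1 hi).2.le) (fun j hj => by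
        obtain ⟨hjs, hj⟩ := Finset.mem_filter.1 hj
        have : ((s.filter fun i => f a < f i).filter fun i => f j - f a ≤ f i - f a)
            = s.filter fun i => f j ≤ f i := by
          ext i
          simp only [Finset.mem_filter, sub_le_sub_iff_right]
          constructor
          · rintro ⟨⟨h, -⟩, h'⟩
            exact ⟨h, h'⟩
          · rintro ⟨h, h'⟩
            exact ⟨⟨h, hj.trans_le h'⟩, h'⟩
        rw [this]
        exact hg j hjs)
    have hext : ∑ i ∈ s with f a < f i, (f i - f a) * g i = ∑ i ∈ s, (f i - f a) * g i := by
      apply Finset.sum_subset hsub.1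
      intro i hi hni
      have : f i = f a := by
        by_contra hne
        exact hni (Finset.mem_filter.2 ⟨hi, lt_of_le_of_ne (hmin i hi) (Ne.symm hne)⟩)
      simp [this]
    have hsplit : ∑ i ∈ s, f i * g i = f a * ∑ i ∈ s, g i + ∑ i ∈ s, (f i - f a) * g i := by
      rw [Finset.mul_sum, ← Finset.sum_add_distrib]
      exact Finset.sum_congr rfl fun i _ => by ring
    rw [hsplit, ← hext]
    exact add_nonneg (mul_nonneg (hf a ha) htot) hrec

/-- Decomposition of a weighted polymatroid by density. The weight `w` is split as
`w = (w / u) * u` so that the importances `u` have total at most the rank, and on each upper level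
set of the strength `w / u` the importance of every contraction is at least its rank. -/
theorem exists_importance {ι : Type*} [DecidableEq ι] (r : Finset ι → ℝ)
    (mono : ∀ A B, A ⊆ B → r A ≤ r B) (empty : r ∅ = 0)
    (submod : ∀ A B, r (A ∪ B) + r (A ∩ B) ≤ r A + r B) (w : ι → ℝ) (T : Finset ι)
    (hw : ∀ i ∈ T, 0 < w i) :
    ∃ u : ι → ℝ, (∀ i, 0 ≤ u i) ∧ (∀ i ∉ T, u i = 0) ∧ ∑ i ∈ T, u i ≤ r T ∧
      (∀ i ∈ T, u i = 0 → r {i} = 0) ∧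
      (∀ ρ, (∀ B ⊆ T, ρ * (r T - r B) ≤ ∑ i ∈ T \ B, w i) → ∀ i ∈ T, ρ * u i ≤ w i) ∧
      ∀ κ, ∀ A ⊆ T.filter (fun i => κ * u i ≤ w i),
        r (T.filter fun i => κ * u i ≤ w i) - r A
          ≤ ∑ i ∈ (T.filter fun i => κ * u i ≤ w i) \ A, u i := by
  induction T using Finset.strongInduction with
  | H T ih =>
    have rnonneg : ∀ A, 0 ≤ r A := fun A => empty ▸ mono ∅ A (Finset.empty_subset A)
    rcases (rnonneg T).eq_or_lt with h0 | hpos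
    · have hz : ∀ A ⊆ T, r A = 0 := fun A hA => le_antisymm (h0 ▸ mono A T hA) (rnonneg A)
      refine ⟨fun _ => 0, fun _ => le_rfl, fun _ _ => rfl, by simp [← h0],
        fun i hi _ => hz _ (by simpa using hi),
        fun ρ _ i hi => by simpa using (hw i hi).le, fun κ A hA => ?_⟩
      rw [hz _ (Finset.filter_subset _ T), hz A (hA.trans (Finset.filter_subset _ T))]
      simp
    -- `A₀` minimizes the density of the contraction `T / A₀`. Coordinates outside `A₀` get the
    -- constant strength `ρ`, the minimum density; those inside are handled by recursion.
    obtain ⟨A₀, hA₀, hmin⟩ := (T.powerset.filter fun A => r A < r T).exists_min_image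
      (fun A => (∑ i ∈ T \ A, w i) / (r T - r A)) ⟨∅, by simp [empty, hpos]⟩
    obtain ⟨hA₀T, hA₀r⟩ := Finset.mem_filter.1 hA₀
    rw [Finset.mem_powerset] at hA₀T
    have hss : A₀ ⊂ T := hA₀T.ssubset_of_ne (by rintro rfl; exact lt_irrefl _ hA₀r)
    obtain ⟨u', hu0, -, husum, huz, hurho, huT⟩ := ih A₀ hss (fun i hi => hw i (hA₀T hi))
    set ρ := (∑ i ∈ T \ A₀, w i) / (r T - r A₀) with hρ
    have hd : 0 < r T - r A₀ := sub_pos.2 hA₀r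
    have hρpos : 0 < ρ := by
      refine div_pos (Finset.sum_pos (fun i hi => hw i (Finset.mem_sdiff.1 hi).1) ?_) hd
      exact Finset.sdiff_nonempty.2 hss.2
    have hρeq : ∑ i ∈ T \ A₀, w i = ρ * (r T - r A₀) := by
      rw [hρ, div_mul_cancel₀ _ hd.ne']
    have hρle : ∀ B ⊆ T, ρ * (r T - r B) ≤ ∑ i ∈ T \ B, w i := by
      intro B hB
      rcases (mono B T hB).lt_or_eq with h | h
      · have := hmin B (Finset.mem_filter.2 ⟨Finset.mem_powerset.2 hB, h⟩)
        exact (le_div_iff₀ (sub_pos.2 h)).1 this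
      · rw [h, sub_self, mul_zero]
        exact Finset.sum_nonneg fun i hi => (hw i (Finset.mem_sdiff.1 hi).1).le
    -- Minimality of `ρ` makes every contraction of `A₀` at least `ρ`-dense, so strengths inside
    -- `A₀` are at least `ρ`.
    have hle' : ∀ i ∈ A₀, ρ * u' i ≤ w i := by
      apply hurho
      intro B hB
      have h1 := hρle B (hB.trans hA₀T)
      have h2 : ∑ i ∈ T \ B, w i = ∑ i ∈ T \ A₀, w i + ∑ i ∈ A₀ \ B, w i := by
        rw [← Finset.sum_union]
        · congr 1
          ext i
          simp only [Finset.mem_sdiff, Finset.mem_union]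
          have := @hA₀T i
          have := @hB i
          tauto
        · exact Finset.disjoint_left.2 fun i hi hi' =>
            (Finset.mem_sdiff.1 hi).2 (Finset.mem_sdiff.1 hi').1
      nlinarith
    set u : ι → ℝ := fun i => if i ∈ A₀ then u' i else if i ∈ T then w i / ρ else 0 with hu
    have huA : ∀ i ∈ A₀, u i = u' i := fun i hi => by simp [hu, hi]
    have huS : ∀ i ∈ T \ A₀, u i = w i / ρ := fun i hi => by
      obtain ⟨h1, h2⟩ := Finset.mem_sdiff.1 hi
      simp [hu, h1, h2]
    have huw : ∀ i ∈ T, ρ * u i ≤ w i := by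
      intro i hi
      by_cases h : i ∈ A₀
      · rw [huA i h]
        exact hle' i h
      · rw [huS i (Finset.mem_sdiff.2 ⟨hi, h⟩), mul_div_cancel₀ _ hρpos.ne']
    have hunn : ∀ i, 0 ≤ u i := by
      intro i
      simp only [hu]
      split_ifs with h1 h2
      · exact hu0 i
      · exact div_nonneg (hw i h2).le hρpos.le
      · exact le_rfl
    refine ⟨u, hunn, fun i hi => by simp [hu, hi, show i ∉ A₀ from fun h => hi (hA₀T h)],
      ?_, ?_, ?_, ?_⟩
    · have h1 : ∑ i ∈ T \ A₀, u i = r T - r A₀ := by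
        rw [Finset.sum_congr rfl huS, ← Finset.sum_div, hρeq, mul_div_cancel_left₀ _ hρpos.ne']
      rw [← Finset.sum_sdiff hA₀T, h1, Finset.sum_congr rfl huA]
      linarith
    · intro i hi hi0
      by_cases h : i ∈ A₀
      · exact huz i h (huA i h ▸ hi0)
      · rw [huS i (Finset.mem_sdiff.2 ⟨hi, h⟩)] at hi0
        exact absurd hi0 (div_pos (hw i hi) hρpos).ne'
    · intro ρ₀ h i hi
      have : ρ₀ ≤ ρ := by
        have := h A₀ hA₀T
        rw [hρeq] at this
        exact le_of_mul_le_mul_right this hd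
      exact (mul_le_mul_of_nonneg_right this (hunn i)).trans (huw i hi)
    · intro κ A hA
      rcases le_or_gt κ ρ with hκ | hκ
      · have hfull : (T.filter fun i => κ * u i ≤ w i) = T := Finset.filter_true_of_mem
          fun i hi => (mul_le_mul_of_nonneg_right hκ (hunn i)).trans (huw i hi)
        rw [hfull] at hA ⊢
        have hfull' : (A₀.filter fun i => ρ * u' i ≤ w i) = A₀ := Finset.filter_true_of_mem hle'
        have h1 := huT ρ (A ∩ A₀) (by rw [hfull']; exact Finset.inter_subset_right)
        rw [hfull'] at h1
        have h2 := hρle (A ∪ A₀) (Finset.union_subset hA hA₀T)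
        have h3 := submod A A₀
        have h4 : T \ A = (T \ (A ∪ A₀)) ∪ (A₀ \ (A ∩ A₀)) := by
          ext i
          simp only [Finset.mem_sdiff, Finset.mem_union, Finset.mem_inter]
          have := @hA₀T i
          tauto
        have h5 : Disjoint (T \ (A ∪ A₀)) (A₀ \ (A ∩ A₀)) :=
          Finset.disjoint_left.2 fun i hi hi' => (Finset.mem_sdiff.1 hi).2
            (Finset.mem_union_right _ (Finset.mem_sdiff.1 hi').1)
        have h6 : ∑ i ∈ T \ (A ∪ A₀), u i = (∑ i ∈ T \ (A ∪ A₀), w i) / ρ := by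
          rw [Finset.sum_div]
          refine Finset.sum_congr rfl fun i hi => huS i ?_
          simp only [Finset.mem_sdiff, Finset.mem_union] at hi ⊢
          tauto
        have h7 : ∑ i ∈ A₀ \ (A ∩ A₀), u i = ∑ i ∈ A₀ \ (A ∩ A₀), u' i :=
          Finset.sum_congr rfl fun i hi => huA i (Finset.mem_sdiff.1 hi).1
        rw [h4, Finset.sum_union h5, h6, h7]
        have h8 : r T - r (A ∪ A₀) ≤ (∑ i ∈ T \ (A ∪ A₀), w i) / ρ := by
          rw [le_div_iff₀ hρpos, mul_comm]
          exact h2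
        linarith
      -- Above `ρ` no coordinate outside `A₀` survives, so the level belongs to the recursion.
      · have heq : (T.filter fun i => κ * u i ≤ w i) = A₀.filter fun i => κ * u' i ≤ w i := by
          ext i
          simp only [Finset.mem_filter]
          constructor
          · rintro ⟨hi, h⟩
            by_cases hiA : i ∈ A₀
            · exact ⟨hiA, huA i hiA ▸ h⟩
            · exfalso
              rw [huS i (Finset.mem_sdiff.2 ⟨hi, hiA⟩), ← mul_div_assoc,
                div_le_iff₀ hρpos] at h
              nlinarith [hw i hi]
          · rintro ⟨hiA, h⟩
            exact ⟨hA₀T hiA, (huA i hiA).symm ▸ h⟩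
        rw [heq] at hA ⊢
        refine (huT κ A hA).trans (Finset.sum_congr rfl fun i hi => ?_).le
        exact (huA i (Finset.mem_filter.1 (Finset.mem_sdiff.1 hi).1).1).symm

/-! ### Importance sampling and Chernoff bounds -/

/-- Union bound over a product distribution: if the exponential tail bounds for finitely many sums of
independent terms add up to less than `1`, then some outcome respects all of them. -/
theorem exists_forall_sum_lt {ι κ : Type*} [Fintype ι] [DecidableEq ι] [Fintype κ]
    (p : ι → ℝ) (hp0 : ∀ i, 0 ≤ p i) (hp1 : ∀ i, p i ≤ 1) (F : κ → ι → Bool → ℝ) (c : κ → ℝ)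
    (hF : ∑ k, Real.exp (-c k) *
      ∏ i, (p i * Real.exp (F k i true) + (1 - p i) * Real.exp (F k i false)) < 1) :
    ∃ x : ι → Bool, ∀ k, ∑ i, F k i (x i) < c k := by
  by_contra! hcon
  let q : ι → Bool → ℝ := fun i b => if b then p i else 1 - p i
  have hq : ∀ i b, 0 ≤ q i b := by
    rintro i (_ | _)
    · simpa [q] using hp1 i
    · simpa [q] using hp0 i
  have hexp : ∀ f : ι → Bool → ℝ, ∏ i, (q i true * f i true + q i false * f i false)
      = ∑ x : ι → Bool, ∏ i, q i (x i) * f i (x i) := by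
    intro f
    have := Finset.prod_univ_sum (fun _ : ι => (Finset.univ : Finset Bool))
      (fun i b => q i b * f i b)
    rw [Fintype.piFinset_univ] at this
    simpa only [Fintype.sum_bool] using this
  have h1 : ∑ x : ι → Bool, ∏ i, q i (x i) = 1 := by
    have := hexp fun _ _ => 1
    simpa [q] using this.symm
  have h2 : ∑ k, Real.exp (-c k) *
        ∏ i, (p i * Real.exp (F k i true) + (1 - p i) * Real.exp (F k i false))
      = ∑ x : ι → Bool, (∏ i, q i (x i)) * ∑ k, Real.exp (∑ i, F k i (x i) - c k) := by
    simp_rw [Finset.mul_sum]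
    rw [Finset.sum_comm]
    refine Finset.sum_congr rfl fun k _ => ?_
    have := hexp fun i b => Real.exp (F k i b)
    simp only [q, if_true, Bool.false_eq_true, if_false] at this
    rw [this, Finset.mul_sum]
    refine Finset.sum_congr rfl fun x _ => ?_
    rw [Finset.prod_mul_distrib, sub_eq_add_neg, Real.exp_add, Real.exp_sum]
    ring
  rw [h2] at hF
  refine absurd hF (not_lt.2 ?_)
  calc (1 : ℝ) = ∑ x : ι → Bool, ∏ i, q i (x i) := h1.symm
    _ ≤ _ := Finset.sum_le_sum fun x _ => le_mul_of_one_le_right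
      (Finset.prod_nonneg fun i _ => hq _ _) ?_
  obtain ⟨k, hk⟩ := hcon x
  exact (Real.one_le_exp (sub_nonneg.2 hk)).trans
    (Finset.single_le_sum (f := fun k => Real.exp (∑ i, F k i (x i) - c k))
      (fun _ _ => (Real.exp_pos _).le) (Finset.mem_univ k))

/-- Moment generating function of one importance-sampled term. -/
theorem sampling_mgf_le {u C l : ℝ} (hu : 0 ≤ u) (hC : 0 < C) (hl : |l| ≤ C) :
    min 1 (C * u) * Real.exp (l * (u / min 1 (C * u) - u))
      + (1 - min 1 (C * u)) * Real.exp (l * (0 - u)) ≤ Real.exp (l ^ 2 * u / C) := by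
  rcases le_or_gt 1 (C * u) with h | h
  · rw [min_eq_left h]
    simp only [div_one, sub_self, mul_zero, Real.exp_zero, zero_mul, add_zero, mul_one]
    exact Real.one_le_exp (by positivity)
  rw [min_eq_right h.le]
  rcases hu.eq_or_lt with rfl | hu'
  · simp
  set x := l / C with hx
  set p := C * u with hp
  have hp0 : 0 < p := by positivity
  have hxl : |x| ≤ 1 := by
    rw [hx, abs_div, abs_of_pos hC]
    exact (div_le_one hC).2 hl
  have e1 : l * (u / p - u) = x * (1 - p) := by
    rw [hx, hp]
    field_simp
  have e2 : l * (0 - u) = -(x * p) := by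
    rw [hx, hp]
    field_simp
    ring
  have e3 : l ^ 2 * u / C = x ^ 2 * p := by
    rw [hx, hp]
    field_simp
  rw [e1, e2, e3]
  have b1 : |x * (1 - p)| ≤ 1 := by
    rw [abs_mul]
    exact mul_le_one₀ hxl (abs_nonneg _) (abs_le.2 ⟨by linarith, by linarith⟩)
  have b2 : |-(x * p)| ≤ 1 := by
    rw [abs_neg, abs_mul]
    exact mul_le_one₀ hxl (abs_nonneg _) (abs_le.2 ⟨by linarith, by linarith⟩)
  -- Use `exp t ≤ 1 + t + t ^ 2` for `|t| ≤ 1`; the linear terms cancel because the sampled term has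
  -- mean zero.
  have c1 := (abs_le.1 (Real.abs_exp_sub_one_sub_id_le b1)).2
  have c2 := (abs_le.1 (Real.abs_exp_sub_one_sub_id_le b2)).2
  have d1 := mul_le_mul_of_nonneg_left
    (show Real.exp (x * (1 - p)) ≤ 1 + x * (1 - p) + (x * (1 - p)) ^ 2 by linarith) hp0.le
  have d2 := mul_le_mul_of_nonneg_left
    (show Real.exp (-(x * p)) ≤ 1 + -(x * p) + (-(x * p)) ^ 2 by linarith) (sub_nonneg.2 h.le)
  have d3 := Real.add_one_le_exp (x ^ 2 * p)
  nlinarith [mul_nonneg (sq_nonneg x) (sq_nonneg p)]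

/-- Layered union bound: a family of sets with at most `b ^ n` members of weight at most `n`, all of
weight at least `1`, has small total `∑ b ^ (-4 * weight)`. -/
theorem sum_exp_neg_le_of_card_le {α : Type*} (s : Finset α) (f : α → ℝ) {b : ℝ} (hb : 4 ≤ b)
    (hf : ∀ a ∈ s, 1 ≤ f a)
    (hcard : ∀ n : ℕ, 1 ≤ n → ((s.filter fun a => f a ≤ n).card : ℝ) ≤ b ^ n) :
    ∑ a ∈ s, Real.exp (-(4 * Real.log b * f a)) ≤ 1 / 8 := by
  have hb0 : 0 < b := by linarith
  have hlog : 0 ≤ Real.log b := Real.log_nonneg (by linarith)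
  -- Layer `g = y` has weights between `y + 1` and `y + 2`: at most `b ^ (y + 2)` members, each
  -- contributing at most `b ^ (-4 * (y + 1))`.
  let g : α → ℕ := fun a => ⌊f a⌋₊ - 1
  have hg1 : ∀ a ∈ s, (g a : ℝ) + 1 ≤ f a := by
    intro a ha
    have h1 : 1 ≤ ⌊f a⌋₊ := (Nat.one_le_floor_iff _).2 (hf a ha)
    have : (g a : ℝ) + 1 = ⌊f a⌋₊ := by
      simp only [g]
      rw [Nat.cast_sub h1]
      simp
    rw [this]
    exact Nat.floor_le (by linarith [hf a ha])
  have hg2 : ∀ a ∈ s, f a ≤ ((g a + 2 : ℕ) : ℝ) := by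
    intro a ha
    have h1 : 1 ≤ ⌊f a⌋₊ := (Nat.one_le_floor_iff _).2 (hf a ha)
    have : g a + 2 = ⌊f a⌋₊ + 1 := by
      simp only [g]
      omega
    rw [this]
    push_cast
    exact (Nat.lt_floor_add_one _).le
  have hterm : ∀ a ∈ s, Real.exp (-(4 * Real.log b * f a)) ≤ (b ^ (4 * (g a + 1)))⁻¹ := by
    intro a ha
    rw [← Real.exp_log (pow_pos hb0 _), ← Real.exp_neg, Real.log_pow]
    refine Real.exp_le_exp.2 (neg_le_neg ?_)
    push_cast
    nlinarith [mul_le_mul_of_nonneg_left (hg1 a ha) hlog]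
  obtain ⟨N, hN⟩ : ∃ N, ∀ a ∈ s, g a ∈ Finset.range N :=
    ⟨s.sup g + 1, fun a ha => Finset.mem_range.2 (Nat.lt_succ_of_le (Finset.le_sup ha))⟩
  have hfib : ∀ y : ℕ, ∑ a ∈ s with g a = y, (b ^ (4 * (g a + 1)))⁻¹ ≤ 1 / 16 * (1 / 2) ^ y := by
    intro y
    have h1 : ∑ a ∈ s with g a = y, (b ^ (4 * (g a + 1)))⁻¹
        = ((s.filter fun a => g a = y).card : ℝ) * (b ^ (4 * (y + 1)))⁻¹ := by
      rw [← nsmul_eq_mul, ← Finset.sum_const]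
      exact Finset.sum_congr rfl fun a ha => by rw [(Finset.mem_filter.1 ha).2]
    have h2 : ((s.filter fun a => g a = y).card : ℝ) ≤ b ^ (y + 2) := by
      refine le_trans ?_ (hcard (y + 2) (by omega))
      refine Nat.cast_le.2 (Finset.card_le_card fun a ha => ?_)
      obtain ⟨h, rfl⟩ := Finset.mem_filter.1 ha
      exact Finset.mem_filter.2 ⟨h, hg2 a h⟩
    have h3 : b ^ (4 * (y + 1)) = b ^ (y + 2) * (b ^ 2 * b ^ (3 * y)) := by ring
    have h4 : (16 : ℝ) * 2 ^ y ≤ b ^ 2 * b ^ (3 * y) := by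
      have : (2 : ℝ) ^ y ≤ b ^ (3 * y) :=
        calc (2 : ℝ) ^ y ≤ b ^ y := pow_le_pow_left₀ (by norm_num) (by linarith) y
          _ ≤ b ^ (3 * y) := pow_le_pow_right₀ (by linarith) (by omega)
      exact mul_le_mul (by nlinarith) this (by positivity) (by positivity)
    rw [h1]
    calc _ ≤ b ^ (y + 2) * (b ^ (4 * (y + 1)))⁻¹ :=
          mul_le_mul_of_nonneg_right h2 (by positivity)
      _ = (b ^ 2 * b ^ (3 * y))⁻¹ := by
          rw [h3]
          field_simp
      _ ≤ ((16 : ℝ) * 2 ^ y)⁻¹ := inv_anti₀ (by positivity) h4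
      _ = 1 / 16 * (1 / 2) ^ y := by
          rw [one_div_pow]
          field_simp
  calc _ ≤ ∑ a ∈ s, (b ^ (4 * (g a + 1)))⁻¹ := Finset.sum_le_sum hterm
    _ = ∑ y ∈ Finset.range N, ∑ a ∈ s with g a = y, (b ^ (4 * (g a + 1)))⁻¹ :=
        (Finset.sum_fiberwise_of_maps_to hN _).symm
    _ ≤ ∑ y ∈ Finset.range N, 1 / 16 * (1 / 2) ^ y := Finset.sum_le_sum fun y _ => hfib y
    _ ≤ 1 / 16 * 2 := by
        rw [← Finset.mul_sum]
        exact mul_le_mul_of_nonneg_left (sum_geometric_two_le N) (by norm_num)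
    _ = 1 / 8 := by norm_num

/-- Importance sampling: a family of sets of `u`-weight at least `1` with few members of small weight
has a sparse reweighting preserving the `u`-weights of all its members. -/
theorem exists_sparse_reweighting {ι : Type*} [Fintype ι] [DecidableEq ι] (u : ι → ℝ)
    (hu : ∀ i, 0 ≤ u i) (F : Finset (Finset ι)) {b : ℝ} (hb : 4 ≤ b)
    (hF : ∀ S ∈ F, 1 ≤ ∑ i ∈ S, u i)
    (hcard : ∀ n : ℕ, 1 ≤ n → ((F.filter fun S => ∑ i ∈ S, u i ≤ n).card : ℝ) ≤ b ^ n)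
    {R : ℝ} (hR : 1 ≤ R) (huR : ∑ i, u i ≤ R) {ε : ℝ} (hε : 0 < ε) (hε1 : ε < 1) :
    ∃ y : ι → ℝ, (∀ i, 0 ≤ y i) ∧
      (∀ S ∈ F, |∑ i ∈ S, (y i - 1) * u i| ≤ ε * ∑ i ∈ S, u i) ∧
      ((Finset.univ.filter fun i => y i ≠ 0).card : ℝ) ≤ 48 * (Real.log b * R / ε ^ 2) := by
  have hlog : 1 < Real.log b := by
    rw [Real.lt_log_iff_exp_lt (by linarith)]
    linarith [Real.exp_one_lt_d9]
  set C := 16 * Real.log b / ε ^ 2 with hC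
  have hC0 : 0 < C := by positivity
  have hC16 : 16 ≤ C := by
    rw [hC, le_div_iff₀ (by positivity)]
    nlinarith
  set p : ι → ℝ := fun i => min 1 (C * u i) with hp
  have hp0 : ∀ i, 0 ≤ p i := fun i => le_min zero_le_one (mul_nonneg hC0.le (hu i))
  have hp1 : ∀ i, p i ≤ 1 := fun i => min_le_left _ _
  set D : ι → Bool → ℝ := fun i x => (if x then u i / p i else 0) - u i with hD
  set sgn : Bool → ℝ := fun s => if s then 1 else -1 with hsgn
  -- This minimizes `-l * ε + l ^ 2 / C`, with value `-ε ^ 2 * C / 4 = -4 * log b`; hence the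
  -- constant 16 in `C`.
  set l : ℝ := ε * C / 2 with hl
  have hl0 : 0 < l := by positivity
  have hmgf : ∀ (S : Finset ι) (s : Bool),
      Real.exp (-(l * ε * ∑ i ∈ S, u i)) *
        ∏ i, (p i * Real.exp (if i ∈ S then sgn s * l * D i true else 0)
          + (1 - p i) * Real.exp (if i ∈ S then sgn s * l * D i false else 0))
      ≤ Real.exp (-(4 * Real.log b * ∑ i ∈ S, u i)) := by
    intro S s
    have hsl : |sgn s * l| ≤ C := by
      have : |sgn s * l| = l := by
        cases s <;> simp [hsgn, abs_of_pos hl0]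
      rw [this, hl]
      nlinarith
    have hsq : (sgn s * l) ^ 2 = l ^ 2 := by
      cases s <;> simp [hsgn]
    have key : ∀ i, p i * Real.exp (if i ∈ S then sgn s * l * D i true else 0)
        + (1 - p i) * Real.exp (if i ∈ S then sgn s * l * D i false else 0)
        ≤ if i ∈ S then Real.exp (l ^ 2 / C * u i) else 1 := by
      intro i
      split_ifs with hi
      · have h1 := sampling_mgf_le (hu i) hC0 hsl
        rw [hsq, mul_div_right_comm] at h1
        simpa only [hD, if_true, Bool.false_eq_true, if_false] using h1
      · simp
    have hprod : ∏ i, (p i * Real.exp (if i ∈ S then sgn s * l * D i true else 0)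
          + (1 - p i) * Real.exp (if i ∈ S then sgn s * l * D i false else 0))
        ≤ Real.exp (l ^ 2 / C * ∑ i ∈ S, u i) := by
      calc _ ≤ ∏ i, (if i ∈ S then Real.exp (l ^ 2 / C * u i) else 1) := by
            refine Finset.prod_le_prod (fun i _ => ?_) fun i _ => key i
            exact add_nonneg (mul_nonneg (hp0 i) (Real.exp_pos _).le)
              (mul_nonneg (sub_nonneg.2 (hp1 i)) (Real.exp_pos _).le)
        _ = Real.exp (l ^ 2 / C * ∑ i ∈ S, u i) := by
            rw [Finset.prod_ite_mem, Finset.univ_inter, ← Real.exp_sum, Finset.mul_sum]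
    refine (mul_le_mul_of_nonneg_left hprod (Real.exp_pos _).le).trans ?_
    rw [← Real.exp_add]
    refine Real.exp_le_exp.2 (le_of_eq ?_)
    rw [hl, hC]
    field_simp
    ring
  have hsize : Real.exp (-(3 * C * R)) *
      ∏ i, (p i * Real.exp (if true then 1 else 0)
        + (1 - p i) * Real.exp (if false then 1 else 0)) ≤ 1 / 4 := by
    have hprod : ∏ i, (p i * Real.exp (if true then 1 else 0)
        + (1 - p i) * Real.exp (if false then 1 else 0)) ≤ Real.exp (2 * C * R) := by
      calc _ ≤ ∏ i, Real.exp (2 * C * u i) := by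
            refine Finset.prod_le_prod (fun i _ => ?_) fun i _ => ?_
            · exact add_nonneg (mul_nonneg (hp0 i) (Real.exp_pos _).le)
                (mul_nonneg (sub_nonneg.2 (hp1 i)) (Real.exp_pos _).le)
            · simp only [if_true, Bool.false_eq_true, if_false, Real.exp_zero]
              have h1 := Real.add_one_le_exp (2 * C * u i)
              have h2 : p i ≤ C * u i := min_le_right _ _
              have h3 := Real.exp_one_lt_d9
              nlinarith [hp0 i]
        _ = Real.exp (2 * C * ∑ i, u i) := by rw [← Real.exp_sum, Finset.mul_sum]
        _ ≤ _ := Real.exp_le_exp.2 (mul_le_mul_of_nonneg_left huR (by positivity))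
    refine (mul_le_mul_of_nonneg_left hprod (Real.exp_pos _).le).trans ?_
    rw [← Real.exp_add, show -(3 * C * R) + 2 * C * R = -(C * R) by ring, Real.exp_neg]
    have h4 : (4 : ℝ) ≤ Real.exp (C * R) := by
      have := Real.add_one_le_exp (C * R)
      nlinarith
    rw [one_div]
    exact inv_anti₀ (by norm_num) h4
  -- `none` controls the number of kept coordinates; `some (S, σ)` is one of the two tails for `S`.
  -- The failure bounds add up to `1 / 4 + 2 / 8`.
  obtain ⟨x, hx⟩ := exists_forall_sum_lt (κ := Option (F × Bool)) p hp0 hp1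
    (fun k i s => match k with
      | none => if s then 1 else 0
      | some (S, σ) => if i ∈ S.1 then sgn σ * l * D i s else 0)
    (fun k => match k with
      | none => 3 * C * R
      | some (S, _) => l * ε * ∑ i ∈ S.1, u i) (by
        rw [Fintype.sum_option, Fintype.sum_prod_type]
        have h1 : ∑ S : F, ∑ σ : Bool, Real.exp (-(l * ε * ∑ i ∈ S.1, u i)) *
            ∏ i, (p i * Real.exp (if i ∈ S.1 then sgn σ * l * D i true else 0)
              + (1 - p i) * Real.exp (if i ∈ S.1 then sgn σ * l * D i false else 0))
            ≤ ∑ S : F, ∑ σ : Bool, Real.exp (-(4 * Real.log b * ∑ i ∈ S.1, u i)) :=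
          Finset.sum_le_sum fun S _ => Finset.sum_le_sum fun σ _ => hmgf S.1 σ
        have h2 : ∑ S : F, ∑ σ : Bool, Real.exp (-(4 * Real.log b * ∑ i ∈ S.1, u i))
            = 2 * ∑ S ∈ F, Real.exp (-(4 * Real.log b * ∑ i ∈ S, u i)) := by
          rw [← Finset.sum_coe_sort F, Finset.mul_sum]
          simp
        have h3 := sum_exp_neg_le_of_card_le F (fun S => ∑ i ∈ S, u i) hb hF hcard
        calc _ ≤ (1 / 4 : ℝ) + 2 * (1 / 8) := by
              refine add_le_add hsize (h1.trans ?_)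
              rw [h2]
              exact mul_le_mul_of_nonneg_left h3 (by norm_num)
          _ < 1 := by norm_num)
  refine ⟨fun i => if x i then 1 / p i else 0, fun i => ?_, fun S hS => ?_, ?_⟩
  · dsimp only
    split_ifs
    · exact div_nonneg zero_le_one (hp0 i)
    · exact le_rfl
  · have hsum : ∀ σ : Bool, sgn σ * ∑ i ∈ S, D i (x i) < ε * ∑ i ∈ S, u i := by
      intro σ
      have h := hx (some (⟨S, hS⟩, σ))
      simp only [Finset.sum_ite_mem, Finset.univ_inter, ← Finset.mul_sum] at h
      have h' : l * (sgn σ * ∑ i ∈ S, D i (x i)) < l * (ε * ∑ i ∈ S, u i) := by linarith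
      exact lt_of_mul_lt_mul_left h' hl0.le
    have heq : ∑ i ∈ S, ((if x i then 1 / p i else 0) - 1) * u i = ∑ i ∈ S, D i (x i) := by
      refine Finset.sum_congr rfl fun i _ => ?_
      simp only [hD]
      split_ifs <;> ring
    rw [heq]
    have h1 := hsum true
    have h2 := hsum false
    simp only [hsgn, if_true, Bool.false_eq_true, if_false] at h1 h2
    exact abs_le.2 ⟨by linarith, by linarith⟩
  · have h := hx none
    simp only at h
    have h1 : ((Finset.univ.filter fun i => (if x i then 1 / p i else 0) ≠ 0).card : ℝ)
        ≤ ∑ i, if x i then (1 : ℝ) else 0 := by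
      rw [Finset.sum_boole]
      refine Nat.cast_le.2 (Finset.card_le_card fun i hi => ?_)
      simp only [Finset.mem_filter, Finset.mem_univ, true_and] at hi ⊢
      by_contra hxi
      simp [hxi] at hi
    refine h1.trans (h.le.trans (le_of_eq ?_))
    rw [hC]
    ring

/-! ### Supports, vanishing subgroups and rank -/

open Classical in
/-- The set of non-identity coordinates of `h`. -/
noncomputable def groupSupport {ι G : Type*} [Fintype ι] [Group G] (h : ι → G) : Finset ι :=
  Finset.univ.filter fun i => h i ≠ 1

theorem mem_groupSupport {ι G : Type*} [Fintype ι] [Group G] {h : ι → G} {i : ι} :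
    i ∈ groupSupport h ↔ h i ≠ 1 := by
  simp [groupSupport]

open Classical in
/-- The set of coordinates at which some element of `P` is not the identity. -/
noncomputable def subgroupSupport {ι G : Type*} [Fintype ι] [Group G] (P : Subgroup (ι → G)) :
    Finset ι :=
  Finset.univ.filter fun i => ∃ h ∈ P, h i ≠ 1

theorem mem_subgroupSupport {ι G : Type*} [Fintype ι] [Group G] {P : Subgroup (ι → G)} {i : ι} :
    i ∈ subgroupSupport P ↔ ∃ h ∈ P, h i ≠ 1 := by
  simp [subgroupSupport]

/-- The subgroup of those elements of `H` that are trivial on `A`. -/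
def vanishingSubgroup {ι G : Type*} [Group G] (H : Subgroup (ι → G)) (A : Set ι) :
    Subgroup (ι → G) where
  carrier := {h | h ∈ H ∧ ∀ i ∈ A, h i = 1}
  mul_mem' := by
    rintro a b ⟨ha, ha'⟩ ⟨hb, hb'⟩
    exact ⟨H.mul_mem ha hb, fun i hi => by simp [ha' i hi, hb' i hi]⟩
  one_mem' := ⟨H.one_mem, fun _ _ => rfl⟩
  inv_mem' := by
    rintro a ⟨ha, ha'⟩
    exact ⟨H.inv_mem ha, fun i hi => by simp [ha' i hi]⟩

theorem mem_vanishingSubgroup {ι G : Type*} [Group G] {H : Subgroup (ι → G)} {A : Set ι}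
    {h : ι → G} : h ∈ vanishingSubgroup H A ↔ h ∈ H ∧ ∀ i ∈ A, h i = 1 :=
  Iff.rfl

theorem vanishingSubgroup_le {ι G : Type*} [Group G] (H : Subgroup (ι → G)) (A : Set ι) :
    vanishingSubgroup H A ≤ H :=
  fun _ h => h.1

theorem vanishingSubgroup_anti {ι G : Type*} [Group G] (H : Subgroup (ι → G)) {A B : Set ι}
    (h : A ⊆ B) : vanishingSubgroup H B ≤ vanishingSubgroup H A :=
  fun _ hx => ⟨hx.1, fun i hi => hx.2 i (h hi)⟩

theorem vanishingSubgroup_empty {ι G : Type*} [Group G] (H : Subgroup (ι → G)) :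
    vanishingSubgroup H ∅ = H :=
  le_antisymm (vanishingSubgroup_le H ∅) fun _ h => ⟨h, fun _ hi => hi.elim⟩

theorem card_mul_relIndex_eq {G : Type*} [Group G] {K L : Subgroup G} (h : K ≤ L) :
    Nat.card K * K.relIndex L = Nat.card L := by
  rw [← Subgroup.relIndex_bot_left, Subgroup.relIndex_mul_relIndex _ _ _ bot_le h,
    Subgroup.relIndex_bot_left]

theorem two_mul_card_le_of_lt {G : Type*} [Group G] [Finite G] {K L : Subgroup G} (h : K < L) :
    2 * Nat.card K ≤ Nat.card L := by
  rw [← card_mul_relIndex_eq h.le, mul_comm]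
  refine Nat.mul_le_mul_left _ ?_
  have h0 : K.relIndex L ≠ 0 := Subgroup.index_ne_zero_of_finite
  have h1 : K.relIndex L ≠ 1 := fun h1 => h.not_ge (Subgroup.relIndex_eq_one.1 h1)
  omega

/-- With `V_A ∩ V_B = V_(A ∪ B)`, this says that the index of `V_B` relative to `V_A` is at most
that relative to the larger `V_(A ∩ B)`. Counting cosets needs neither normality nor commutativity.
-/
theorem card_vanishingSubgroup_mul_le {ι G : Type*} [Finite ι] [Group G] [Finite G]
    (H : Subgroup (ι → G)) (A B : Set ι) :
    Nat.card (vanishingSubgroup H A) * Nat.card (vanishingSubgroup H B)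
      ≤ Nat.card (vanishingSubgroup H (A ∪ B)) * Nat.card (vanishingSubgroup H (A ∩ B)) := by
  set VA := vanishingSubgroup H A
  set VB := vanishingSubgroup H B
  have hU : vanishingSubgroup H (A ∪ B) = VB ⊓ VA := by
    ext x
    simp only [VA, VB, Subgroup.mem_inf, mem_vanishingSubgroup, Set.mem_union]
    constructor
    · rintro ⟨h, h'⟩
      exact ⟨⟨h, fun i hi => h' i (Or.inr hi)⟩, h, fun i hi => h' i (Or.inl hi)⟩
    · rintro ⟨⟨h, h1⟩, -, h2⟩
      exact ⟨h, fun i hi => hi.elim (h2 i) (h1 i)⟩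
  have e1 : Nat.card (VB ⊓ VA : Subgroup (ι → G)) * VB.relIndex VA = Nat.card VA := by
    rw [← Subgroup.inf_relIndex_right]
    exact card_mul_relIndex_eq inf_le_right
  have hB : VB ≤ vanishingSubgroup H (A ∩ B) := vanishingSubgroup_anti H Set.inter_subset_right
  have hA : VA ≤ vanishingSubgroup H (A ∩ B) := vanishingSubgroup_anti H Set.inter_subset_left
  rw [hU, ← e1, ← card_mul_relIndex_eq hB, mul_assoc, mul_comm (VB.relIndex VA)]
  gcongr
  exact Subgroup.relIndex_le_of_le_right hA Subgroup.index_ne_zero_of_finite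

/-- The rank of a set of coordinates: the binary logarithm of the size of the projection of `H`. -/
noncomputable def coordRank {ι G : Type*} [Group G] (H : Subgroup (ι → G)) (A : Finset ι) : ℝ :=
  Real.logb 2 (Nat.card H) - Real.logb 2 (Nat.card (vanishingSubgroup H (A : Set ι)))

theorem natCard_subgroup_pos {G : Type*} [Group G] [Finite G] (K : Subgroup G) :
    (0 : ℝ) < Nat.card K :=
  Nat.cast_pos.2 Nat.card_pos

theorem logb_card_le_of_le {G : Type*} [Group G] [Finite G] {K L : Subgroup G} (h : K ≤ L) :
    Real.logb 2 (Nat.card K) ≤ Real.logb 2 (Nat.card L) :=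
  Real.logb_le_logb_of_le one_lt_two (natCard_subgroup_pos K)
    (Nat.cast_le.2 (Subgroup.card_le_of_le h))

theorem logb_card_nonneg {G : Type*} [Group G] [Finite G] (K : Subgroup G) :
    0 ≤ Real.logb 2 (Nat.card K) :=
  Real.logb_nonneg one_lt_two (Nat.one_le_cast.2 Nat.card_pos)

theorem logb_card_add_one_le_of_lt {G : Type*} [Group G] [Finite G] {K L : Subgroup G}
    (h : K < L) : Real.logb 2 (Nat.card K) + 1 ≤ Real.logb 2 (Nat.card L) := by
  have h1 : ((2 * Nat.card K : ℕ) : ℝ) ≤ Nat.card L := Nat.cast_le.2 (two_mul_card_le_of_lt h)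
  have h2 := Real.logb_le_logb_of_le one_lt_two
    (by have := natCard_subgroup_pos K; push_cast; positivity) h1
  rw [Nat.cast_mul, Real.logb_mul (by norm_num) (natCard_subgroup_pos K).ne', Nat.cast_ofNat,
    Real.logb_self_eq_one one_lt_two] at h2
  linarith

theorem coordRank_mono {ι G : Type*} [Finite ι] [Group G] [Finite G] (H : Subgroup (ι → G))
    (A B : Finset ι) (h : A ⊆ B) : coordRank H A ≤ coordRank H B :=
  sub_le_sub_left (logb_card_le_of_le (vanishingSubgroup_anti H (Finset.coe_subset.2 h))) _

theorem coordRank_empty {ι G : Type*} [Group G] (H : Subgroup (ι → G)) : coordRank H ∅ = 0 := by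
  rw [coordRank, Finset.coe_empty, vanishingSubgroup_empty, sub_self]

theorem coordRank_le {ι G : Type*} [Finite ι] [Group G] [Finite G] (H : Subgroup (ι → G))
    (A : Finset ι) : coordRank H A ≤ Real.logb 2 (Nat.card H) :=
  sub_le_self _ (logb_card_nonneg _)

theorem coordRank_submodular {ι G : Type*} [Finite ι] [DecidableEq ι] [Group G] [Finite G]
    (H : Subgroup (ι → G)) (A B : Finset ι) :
    coordRank H (A ∪ B) + coordRank H (A ∩ B) ≤ coordRank H A + coordRank H B := by
  have h := card_vanishingSubgroup_mul_le H (A : Set ι) B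
  rw [← Finset.coe_union, ← Finset.coe_inter] at h
  have h1 := Real.logb_le_logb_of_le one_lt_two
    (by rw [Nat.cast_mul]; exact mul_pos (natCard_subgroup_pos _) (natCard_subgroup_pos _))
    (Nat.cast_le (α := ℝ).2 h)
  rw [Nat.cast_mul, Nat.cast_mul,
    Real.logb_mul (natCard_subgroup_pos _).ne' (natCard_subgroup_pos _).ne',
    Real.logb_mul (natCard_subgroup_pos _).ne' (natCard_subgroup_pos _).ne'] at h1
  simp only [coordRank]
  linarith

theorem eq_one_of_coordRank_singleton_eq_zero {ι G : Type*} [Finite ι] [Group G] [Finite G]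
    {H : Subgroup (ι → G)} {i : ι} (hi : coordRank H {i} = 0) {h : ι → G} (hh : h ∈ H) :
    h i = 1 := by
  by_contra hne
  have hlt : vanishingSubgroup H (({i} : Finset ι) : Set ι) < H := by
    refine lt_of_le_of_ne (vanishingSubgroup_le _ _) fun heq => hne ?_
    rw [← heq] at hh
    exact hh.2 i (by simp)
  have := logb_card_add_one_le_of_lt hlt
  rw [coordRank] at hi
  linarith

/-- The projection onto the coordinates in `T`, extended by the identity elsewhere. -/
def restrictCoords {ι : Type*} (G : Type*) [DecidableEq ι] [Group G] (T : Finset ι) :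
    (ι → G) →* (ι → G) where
  toFun h i := if i ∈ T then h i else 1
  map_one' := by
    ext i
    simp
  map_mul' a b := by
    ext i
    by_cases hi : i ∈ T <;> simp [hi]

theorem restrictCoords_apply {ι G : Type*} [DecidableEq ι] [Group G] (T : Finset ι) (h : ι → G)
    (i : ι) : restrictCoords G T h i = if i ∈ T then h i else 1 :=
  rfl

theorem groupSupport_restrictCoords {ι G : Type*} [Fintype ι] [DecidableEq ι] [Group G]
    (T : Finset ι) (h : ι → G) : groupSupport (restrictCoords G T h) = T ∩ groupSupport h := by
  ext i
  simp [mem_groupSupport, restrictCoords_apply]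

/-- Lifting `Q` to `H` and multiplying by the kernel of the projection injects `Q × V_T` into the
elements vanishing on `T \ supp Q`. So `log₂ |Q|` is at most the rank of `T` contracted by `T \ supp
Q`. -/
theorem logb_card_le_of_le_map_restrictCoords {ι G : Type*} [Fintype ι] [DecidableEq ι] [Group G]
    [Finite G] {H : Subgroup (ι → G)} {T : Finset ι} {u : ι → ℝ}
    (hT : ∀ A ⊆ T, coordRank H T - coordRank H A ≤ ∑ i ∈ T \ A, u i)
    {Q : Subgroup (ι → G)} (hQ : Q ≤ H.map (restrictCoords G T)) :
    Real.logb 2 (Nat.card Q) ≤ ∑ i ∈ subgroupSupport Q, u i := by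
  have hsub : subgroupSupport Q ⊆ T := by
    intro i hi
    obtain ⟨q, hq, hqi⟩ := mem_subgroupSupport.1 hi
    obtain ⟨h, -, rfl⟩ := hQ hq
    by_contra hiT
    exact hqi (by simp [restrictCoords_apply, hiT])
  have h1 := hT (T \ subgroupSupport Q) Finset.sdiff_subset
  rw [Finset.sdiff_sdiff_eq_self hsub] at h1
  refine le_trans ?_ h1
  choose σ hσH hσ using fun q : Q => hQ q.2
  let f : Q × vanishingSubgroup H (T : Set ι) →
      vanishingSubgroup H ((T \ subgroupSupport Q : Finset ι) : Set ι) := fun x =>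
    ⟨σ x.1 * x.2.1, H.mul_mem (hσH _) x.2.2.1, fun i hi => by
      obtain ⟨hiT, hiQ⟩ := Finset.mem_sdiff.1 (Finset.mem_coe.1 hi)
      have h2 : x.1.1 i = 1 := by
        by_contra hne
        exact hiQ (mem_subgroupSupport.2 ⟨_, x.1.2, hne⟩)
      rw [← hσ x.1, restrictCoords_apply, if_pos hiT] at h2
      simp [h2, x.2.2.2 i hiT]⟩
  have hf : Function.Injective f := by
    rintro ⟨q, v⟩ ⟨q', v'⟩ h
    have h2 : σ q * v.1 = σ q' * v'.1 := congrArg Subtype.val h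
    have hv : ∀ v : vanishingSubgroup H (T : Set ι), restrictCoords G T v.1 = 1 := by
      intro v
      ext i
      rw [restrictCoords_apply]
      split_ifs with hi
      · exact v.2.2 i hi
      · rfl
    have h3 : q = q' := by
      have := congrArg (restrictCoords G T) h2
      rw [map_mul, map_mul, hσ, hσ, hv, hv, mul_one, mul_one] at this
      exact Subtype.ext this
    subst h3
    exact Prod.ext rfl (Subtype.ext (mul_left_cancel h2))
  have hcard := Nat.card_le_card_of_injective f hf
  rw [Nat.card_prod] at hcard
  have h4 := Real.logb_le_logb_of_le one_lt_two
    (by rw [Nat.cast_mul]; exact mul_pos (natCard_subgroup_pos _) (natCard_subgroup_pos _))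
    (Nat.cast_le (α := ℝ).2 hcard)
  rw [Nat.cast_mul, Real.logb_mul (natCard_subgroup_pos _).ne' (natCard_subgroup_pos _).ne'] at h4
  simp only [coordRank]
  linarith

/-! ### Counting light elements by contraction -/

/-- Contraction bound on the number of light elements: if every subgroup of `P` has weight at least
the binary logarithm of its size, then `P` has few elements of small weight. -/
theorem ncard_light_le {ι G : Type*} [Fintype ι] [Group G] [Finite G] (u : ι → ℝ)
    (hu : ∀ i, 0 ≤ u i) {n : ℕ} (hn : 1 ≤ n) (P : Subgroup (ι → G))
    (hP : ∀ Q ≤ P, Real.logb 2 (Nat.card Q) ≤ ∑ i ∈ subgroupSupport Q, u i) {L : ℝ} (hL : 1 ≤ L)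
    (hPL : Real.logb 2 (Nat.card P) ≤ L) :
    ({h | h ∈ P ∧ ∑ i ∈ groupSupport h, u i ≤ n}.ncard : ℝ) ≤ (4 * L ^ 2) ^ n := by
  induction hN : Nat.card P using Nat.strong_induction_on generalizing P L with
  | _ N ih =>
    set k := Real.logb 2 (Nat.card P) with hk
    have hn' : (1 : ℝ) ≤ n := Nat.one_le_cast.2 hn
    rcases le_or_gt k (2 * n) with hkn | hkn
    · have h1 : ({h | h ∈ P ∧ ∑ i ∈ groupSupport h, u i ≤ n}.ncard : ℝ) ≤ Nat.card P :=
        Nat.cast_le.2 (Set.ncard_le_ncard (t := (P : Set (ι → G))) (fun h hh => hh.1)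
          (Set.toFinite _))
      have h2 : (Nat.card P : ℝ) = 2 ^ k := by
        rw [hk, Real.rpow_logb two_pos (by norm_num) (natCard_subgroup_pos P)]
      calc _ ≤ (Nat.card P : ℝ) := h1
        _ = 2 ^ k := h2
        _ ≤ (2 : ℝ) ^ ((2 * n : ℕ) : ℝ) :=
            Real.rpow_le_rpow_of_exponent_le one_le_two (by push_cast; exact hkn)
        _ = 4 ^ n := by
            rw [Real.rpow_natCast, pow_mul]
            norm_num
        _ ≤ (4 * L ^ 2) ^ n := pow_le_pow_left₀ (by norm_num) (by nlinarith) n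
    set light : Set (ι → G) := {h | h ∈ P ∧ ∑ i ∈ groupSupport h, u i ≤ n} with hlight
    set s := ∑ i ∈ subgroupSupport P, u i with hs
    have hks : k ≤ s := hP P le_rfl
    classical
    have hfin : light.Finite := Set.toFinite _
    set F := hfin.toFinset with hF
    have hFc : light.ncard = F.card := Set.ncard_eq_toFinset_card _ hfin
    set V : ι → Subgroup (ι → G) := fun i => vanishingSubgroup P {i} with hV
    have hlightV : ∀ i, ((F.filter fun h => h i = 1).card : ℝ)
        = {h | h ∈ V i ∧ ∑ i ∈ groupSupport h, u i ≤ n}.ncard := by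
      intro i
      rw [← Set.ncard_coe_finset]
      congr 2
      ext h
      simp only [Finset.coe_filter, hF, Set.Finite.mem_toFinset, hlight, Set.mem_ofPred_eq, hV,
        mem_vanishingSubgroup, Set.mem_singleton_iff, forall_eq]
      tauto
    -- Double counting in place of a random contraction: drawn with probability proportional to `u`,
    -- a coordinate misses a given light element's support with probability at least `1 - n / s`.
    have hdouble : (F.card : ℝ) * (s - n)
        ≤ ∑ i ∈ subgroupSupport P, u i * (F.filter fun h => h i = 1).card := by
      have h1 : ∀ h ∈ F, s - n ≤ ∑ i ∈ subgroupSupport P, if h i = 1 then u i else 0 := by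
        intro h hh
        obtain ⟨hhP, hhn⟩ := (Set.Finite.mem_toFinset hfin).1 hh
        have h2 : s = (∑ i ∈ subgroupSupport P, if h i = 1 then u i else 0)
            + ∑ i ∈ groupSupport h, u i := by
          have h3 : groupSupport h = (subgroupSupport P).filter fun i => ¬ h i = 1 := by
            ext i
            simp only [mem_groupSupport, Finset.mem_filter, mem_subgroupSupport]
            exact ⟨fun hi => ⟨⟨h, hhP, hi⟩, hi⟩, fun hi => hi.2⟩
          rw [h3, ← Finset.sum_filter, Finset.sum_filter_add_sum_filter_not]
        linarith
      calc (F.card : ℝ) * (s - n) = ∑ _h ∈ F, (s - n) := by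
            rw [Finset.sum_const, nsmul_eq_mul]
        _ ≤ ∑ h ∈ F, ∑ i ∈ subgroupSupport P, (if h i = 1 then u i else 0) :=
            Finset.sum_le_sum h1
        _ = _ := by
            rw [Finset.sum_comm]
            refine Finset.sum_congr rfl fun i _ => ?_
            rw [← Finset.sum_filter, Finset.sum_const, nsmul_eq_mul, mul_comm]
    have hbound : ∀ i ∈ subgroupSupport P,
        ((F.filter fun h => h i = 1).card : ℝ) ≤ (4 * (k - 1) ^ 2) ^ n := by
      intro i hi
      obtain ⟨h, hh, hhi⟩ := mem_subgroupSupport.1 hi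
      have hlt : V i < P := by
        refine lt_of_le_of_ne (vanishingSubgroup_le _ _) fun heq => hhi ?_
        rw [← heq] at hh
        exact hh.2 i rfl
      rw [hlightV]
      refine ih _ ?_ (V i) (fun Q hQ => hP Q (hQ.trans hlt.le)) (by linarith) ?_ rfl
      · rw [← hN]
        have := two_mul_card_le_of_lt hlt
        have : 0 < Nat.card (V i) := Nat.card_pos
        omega
      · have := logb_card_add_one_le_of_lt hlt
        linarith
    have hmain : (F.card : ℝ) * (s - n) ≤ s * (4 * (k - 1) ^ 2) ^ n := by
      refine hdouble.trans ?_
      rw [hs, Finset.sum_mul]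
      exact Finset.sum_le_sum fun i hi => mul_le_mul_of_nonneg_left (hbound i hi) (hu i)
    -- Contraction lowers `k` by at least 1 and costs a factor `k / (k - n)`, at most `1 + 2 * n /
    -- k` as `k > 2 * n`. Bernoulli absorbs it into exponent `2 * n`, hence the square in the bound.
    have hbern : (4 * (k - 1) ^ 2) ^ n * (k + 2 * n) ≤ (4 * k ^ 2) ^ n * k := by
      have hk0 : 0 < k := by linarith
      have h1 := one_add_mul_le_pow (a := 1 / k) (by have : 0 < 1 / k := by positivity
                                                     linarith) (2 * n)
      have h2 : k + 2 * n ≤ k * (1 + 1 / k) ^ (2 * n) := by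
        have := mul_le_mul_of_nonneg_left h1 hk0.le
        push_cast at this
        have e : k * (1 + 2 * n * (1 / k)) = k + 2 * n := by field_simp
        linarith
      have h3 : (4 * (k - 1) ^ 2) ^ n * (1 + 1 / k) ^ (2 * n) ≤ (4 * k ^ 2) ^ n := by
        rw [pow_mul, ← mul_pow]
        refine pow_le_pow_left₀ (by positivity) ?_ n
        have e : 4 * (k - 1) ^ 2 * (1 + 1 / k) ^ 2 = 4 * ((k - 1) * (k + 1) / k) ^ 2 := by
          field_simp
        rw [e]
        have : (k - 1) * (k + 1) / k ≤ k := by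
          rw [div_le_iff₀ hk0]
          nlinarith
        have h0 : 0 ≤ (k - 1) * (k + 1) / k :=
          div_nonneg (mul_nonneg (by linarith) (by linarith)) hk0.le
        nlinarith
      calc _ ≤ (4 * (k - 1) ^ 2) ^ n * (k * (1 + 1 / k) ^ (2 * n)) :=
            mul_le_mul_of_nonneg_left h2 (by positivity)
        _ = ((4 * (k - 1) ^ 2) ^ n * (1 + 1 / k) ^ (2 * n)) * k := by ring
        _ ≤ _ := mul_le_mul_of_nonneg_right h3 hk0.le
    have hfinal : (F.card : ℝ) ≤ (4 * k ^ 2) ^ n := by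
      set a := (4 * (k - 1) ^ 2) ^ n
      have ha : 0 ≤ a := by positivity
      have hk0 : 0 < k := by linarith
      have h1 : (F.card : ℝ) * (k - n) ≤ k * a := by
        have hc : (F.card : ℝ) * (s - n) * k ≤ s * a * k :=
          mul_le_mul_of_nonneg_right hmain hk0.le
        have hc0 : (0 : ℝ) ≤ F.card := Nat.cast_nonneg _
        have hs0 : 0 < s := by linarith
        have h2 : (F.card : ℝ) * (k - n) * s ≤ F.card * (s - n) * k := by
          nlinarith [mul_nonneg hc0
            (mul_nonneg (sub_nonneg.2 hks) (Nat.cast_nonneg (α := ℝ) n))]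
        have h3 : (F.card : ℝ) * (k - n) * s ≤ k * a * s := by linarith
        exact le_of_mul_le_mul_right h3 hs0
      have h2 : k * k ≤ (k - n) * (k + 2 * n) := by nlinarith
      have h3 : (F.card : ℝ) * (k * k) ≤ (4 * k ^ 2) ^ n * (k * k) := by
        calc (F.card : ℝ) * (k * k) ≤ F.card * ((k - n) * (k + 2 * n)) :=
              mul_le_mul_of_nonneg_left h2 (Nat.cast_nonneg _)
          _ = (F.card * (k - n)) * (k + 2 * n) := by ring
          _ ≤ (k * a) * (k + 2 * n) := mul_le_mul_of_nonneg_right h1 (by linarith)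
          _ = (a * (k + 2 * n)) * k := by ring
          _ ≤ ((4 * k ^ 2) ^ n * k) * k := mul_le_mul_of_nonneg_right hbern hk0.le
          _ = _ := by ring
      exact le_of_mul_le_mul_right h3 (by positivity)
    rw [hFc]
    refine hfinal.trans (pow_le_pow_left₀ (by positivity) ?_ n)
    have : 0 ≤ k := by linarith
    nlinarith

/-! ### Assembling the weighted sparsifier -/

theorem groupSupport_eq_empty_iff {ι G : Type*} [Fintype ι] [Group G] {h : ι → G} :
    groupSupport h = ∅ ↔ h = 1 := by
  simp [Finset.eq_empty_iff_forall_notMem, mem_groupSupport, funext_iff]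

theorem subgroupSupport_zpowers_subset {ι G : Type*} [Fintype ι] [Group G] (x : ι → G) :
    subgroupSupport (Subgroup.zpowers x) ⊆ groupSupport x := by
  intro i hi
  obtain ⟨_, ⟨z, rfl⟩, hz⟩ := mem_subgroupSupport.1 hi
  refine mem_groupSupport.2 fun h => hz ?_
  simp [h]

/-- Apply the hypothesis to the cyclic subgroup generated by `x`, which has at least two elements
and no larger support. -/
theorem one_le_sum_groupSupport {ι G : Type*} [Fintype ι] [Group G] [Finite G] {u : ι → ℝ}
    (hu : ∀ i, 0 ≤ u i) {P : Subgroup (ι → G)}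
    (hP : ∀ Q ≤ P, Real.logb 2 (Nat.card Q) ≤ ∑ i ∈ subgroupSupport Q, u i) {x : ι → G}
    (hx : x ∈ P) (hx1 : x ≠ 1) : 1 ≤ ∑ i ∈ groupSupport x, u i := by
  have h1 := hP _ (Subgroup.zpowers_le.2 hx)
  have h2 : (⊥ : Subgroup (ι → G)) < Subgroup.zpowers x := by
    rw [bot_lt_iff_ne_bot]
    exact fun h => hx1 (Subgroup.zpowers_eq_bot.1 h)
  have h3 := logb_card_add_one_le_of_lt h2
  rw [Subgroup.card_bot, Nat.cast_one, Real.logb_one, zero_add] at h3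
  exact h3.trans (h1.trans (Finset.sum_le_sum_of_subset_of_nonneg
    (subgroupSupport_zpowers_subset x) fun i _ _ => hu i))

theorem groupWeight_eq_sum {ι G : Type*} [Fintype ι] [Group G] (w : ι → ℝ≥0) (h : ι → G) :
    groupWeight w h = ∑ i ∈ groupSupport h, (w i : ℝ) := by
  classical
  rw [groupWeight, groupSupport, Finset.sum_filter]
  exact Finset.sum_congr rfl fun i _ => by simp [Set.indicator_apply]

theorem groupWeight_one {ι G : Type*} [Fintype ι] [Group G] (h : ι → G) :
    groupWeight (fun _ => 1) h = groupHamming h := by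
  have : {i | h i ≠ 1} = (groupSupport h : Set ι) := by
    ext i
    simp [mem_groupSupport]
  rw [groupWeight_eq_sum, groupHamming, this, Set.ncard_coe_finset]
  simp

theorem exists_weighted_sparsifier {ι G : Type*} [Fintype ι] [DecidableEq ι] [Group G] [Finite G]
    (H : Subgroup (ι → G)) (w : ι → ℝ≥0) {M : ℝ} (hM : 2 ≤ M) (hι : (Fintype.card ι : ℝ) ≤ M)
    (hH : 1 ≤ Real.logb 2 (Nat.card H)) (hHM : Real.logb 2 (Nat.card H) ≤ M) {ε : ℝ} (hε : 0 < ε)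
    (hε1 : ε < 1) :
    ∃ v : ι → ℝ≥0, IsWeightedGroupSparsifier H w ε v ∧
      (sparsifierSize v : ℝ) ≤ 240 * (Real.log M * Real.logb 2 (Nat.card H) / ε ^ 2) := by
  set W : ι → ℝ := fun i => w i with hW
  set T := Finset.univ.filter fun i => 0 < W i with hTdef
  have hWT : ∀ i ∈ T, 0 < W i := fun i hi => (Finset.mem_filter.1 hi).2
  obtain ⟨u, hu, huT, husum, huz, -, hlev⟩ := exists_importance (coordRank H) (coordRank_mono H)
    (coordRank_empty H) (coordRank_submodular H) W T hWT
  -- If `u j = 0`, the quotient is `0` and the level is all of `T`; this is harmless since `hlev`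
  -- holds for every threshold.
  set level : ι → Finset ι := fun j => T.filter fun i => W j / u j * u i ≤ W i with hlevel
  set P : ι → Subgroup (ι → G) := fun j => H.map (restrictCoords G (level j)) with hPdef
  have hP : ∀ j, ∀ Q ≤ P j, Real.logb 2 (Nat.card Q) ≤ ∑ i ∈ subgroupSupport Q, u i :=
    fun j Q hQ => logb_card_le_of_le_map_restrictCoords (hlev (W j / u j)) hQ
  have hPcard : ∀ j, Real.logb 2 (Nat.card (P j)) ≤ M := fun j => by
    refine le_trans (Real.logb_le_logb_of_le one_lt_two (natCard_subgroup_pos _) ?_) hHM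
    exact Nat.cast_le.2 (Nat.card_le_card_of_surjective (fun h : H =>
      (⟨restrictCoords G (level j) h, Subgroup.mem_map_of_mem _ h.2⟩ : P j))
      (by rintro ⟨_, h, hh, rfl⟩; exact ⟨⟨h, hh⟩, rfl⟩))
  set F : ι → Finset (Finset ι) := fun j =>
    (((Set.toFinite (P j : Set (ι → G))).toFinset.image groupSupport).erase ∅) with hFdef
  have hmemF : ∀ j S, S ∈ F j ↔ ∃ x ∈ P j, x ≠ 1 ∧ groupSupport x = S := by
    intro j S
    simp only [hFdef, Finset.mem_erase, Finset.mem_image, Set.Finite.mem_toFinset, SetLike.mem_coe]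
    constructor
    · rintro ⟨hS, x, hx, rfl⟩
      exact ⟨x, hx, fun h => hS (groupSupport_eq_empty_iff.2 h), rfl⟩
    · rintro ⟨x, hx, hx1, rfl⟩
      exact ⟨fun h => hx1 (groupSupport_eq_empty_iff.1 h), x, hx, rfl⟩
  have hcard : ∀ n : ℕ, 1 ≤ n →
      (((T.biUnion F).filter fun S => ∑ i ∈ S, u i ≤ n).card : ℝ) ≤ (M ^ 5) ^ n := by
    intro n hn
    have h1 : ∀ j, (((F j).filter fun S => ∑ i ∈ S, u i ≤ n).card : ℝ) ≤ (4 * M ^ 2) ^ n := by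
      intro j
      refine le_trans (Nat.cast_le.2 ?_) (ncard_light_le u hu hn (P j) (hP j)
        (by linarith) (hPcard j))
      have hfin : {h | h ∈ P j ∧ ∑ i ∈ groupSupport h, u i ≤ n}.Finite := Set.toFinite _
      rw [Set.ncard_eq_toFinset_card _ hfin]
      refine le_trans (Finset.card_le_card ?_) (Finset.card_image_le (f := groupSupport))
      intro S hS
      obtain ⟨hS, hSn⟩ := Finset.mem_filter.1 hS
      obtain ⟨x, hx, -, rfl⟩ := (hmemF j S).1 hS
      exact Finset.mem_image.2 ⟨x, hfin.mem_toFinset.2 ⟨hx, hSn⟩, rfl⟩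
    have h2 : (((T.biUnion F).filter fun S => ∑ i ∈ S, u i ≤ n).card : ℝ)
        ≤ M * (4 * M ^ 2) ^ n := by
      rw [Finset.filter_biUnion]
      calc _ ≤ ((∑ j ∈ T, ((F j).filter fun S => ∑ i ∈ S, u i ≤ n).card : ℕ) : ℝ) :=
            Nat.cast_le.2 Finset.card_biUnion_le
        _ ≤ ∑ _j ∈ T, (4 * M ^ 2) ^ n := by
            push_cast
            exact Finset.sum_le_sum fun j _ => h1 j
        _ ≤ M * (4 * M ^ 2) ^ n := by
            rw [Finset.sum_const, nsmul_eq_mul]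
            refine mul_le_mul_of_nonneg_right (le_trans ?_ hι) (by positivity)
            exact Nat.cast_le.2 (Finset.card_le_univ _)
    refine h2.trans ?_
    calc M * (4 * M ^ 2) ^ n ≤ M ^ n * (4 * M ^ 2) ^ n :=
          mul_le_mul_of_nonneg_right (le_self_pow₀ (by linarith) (by omega)) (by positivity)
      _ = (4 * M ^ 3) ^ n := by rw [← mul_pow]; ring
      _ ≤ (M ^ 5) ^ n := by
          refine pow_le_pow_left₀ (by positivity) ?_ n
          have : M ^ 5 = M ^ 2 * M ^ 3 := by ring
          rw [this]
          exact mul_le_mul_of_nonneg_right (by nlinarith) (by positivity)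
  have hb : 4 ≤ M ^ 5 := by
    calc (4 : ℝ) ≤ 2 ^ 5 := by norm_num
      _ ≤ M ^ 5 := pow_le_pow_left₀ (by norm_num) hM 5
  have hutot : ∑ i, u i ≤ Real.logb 2 (Nat.card H) := by
    rw [← Finset.sum_subset (Finset.subset_univ T) fun i _ hi => huT i hi]
    exact husum.trans (coordRank_le H T)
  obtain ⟨y, hy0, hyF, hysize⟩ := exists_sparse_reweighting u hu (T.biUnion F) hb
    (fun S hS => by
      obtain ⟨j, -, hj⟩ := Finset.mem_biUnion.1 hS
      obtain ⟨x, hx, hx1, rfl⟩ := (hmemF j S).1 hj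
      exact one_le_sum_groupSupport hu (hP j) hx hx1) hcard hH hutot hε hε1
  refine ⟨fun i => (y i).toNNReal * w i, fun h hh => ?_, ?_⟩
  · set s := T ∩ groupSupport h with hs
    have hsum : ∀ z : ι → ℝ, ∑ i ∈ groupSupport h, z i * W i = ∑ i ∈ s, z i * W i := by
      intro z
      symm
      refine Finset.sum_subset Finset.inter_subset_right fun i hi hi' => ?_
      have : ¬ 0 < W i := fun h0 =>
        hi' (Finset.mem_inter.2 ⟨Finset.mem_filter.2 ⟨Finset.mem_univ i, h0⟩, hi⟩)
      rw [le_antisymm (not_lt.1 this) (w i).2, mul_zero]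
    have hupos : ∀ i ∈ s, 0 < u i := by
      intro i hi
      obtain ⟨hiT, hih⟩ := Finset.mem_inter.1 hi
      refine lt_of_le_of_ne (hu i) fun h0 => mem_groupSupport.1 hih ?_
      exact eq_one_of_coordRank_singleton_eq_zero (huz i hiT h0.symm) hh
    -- The signs `σ = 1` and `σ = -1` give the two sides of the estimate. Each upper level set of `W
    -- / u` within `s` is the support of a projection of `h`, where `y` is accurate.
    have hkey : ∀ σ : ℝ, |σ| = 1 → 0 ≤ ∑ i ∈ s, (ε + σ * (y i - 1)) * W i := by
      intro σ hσ
      have h0 := sum_mul_nonneg_of_upper_level_sums s (fun i => W i / u i)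
        (fun i => (ε + σ * (y i - 1)) * u i)
        (fun i hi => div_nonneg (w i).2 (hu i)) (fun j hj => by
          have hset : (s.filter fun i => W j / u j ≤ W i / u i) = level j ∩ groupSupport h := by
            ext i
            simp only [hs, hlevel, Finset.mem_filter, Finset.mem_inter]
            constructor
            · rintro ⟨hi, hle⟩
              exact ⟨⟨hi.1, (le_div_iff₀ (hupos i (Finset.mem_inter.2 hi))).1 hle⟩, hi.2⟩
            · rintro ⟨⟨hi, hle⟩, hih⟩
              exact ⟨⟨hi, hih⟩, (le_div_iff₀ (hupos i (Finset.mem_inter.2 ⟨hi, hih⟩))).2 hle⟩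
          have hjmem : j ∈ level j ∩ groupSupport h := by
            rw [← hset]
            exact Finset.mem_filter.2 ⟨hj, le_rfl⟩
          have hmem : level j ∩ groupSupport h ∈ T.biUnion F := by
            refine Finset.mem_biUnion.2 ⟨j, (Finset.mem_inter.1 hj).1, (hmemF _ _).2
              ⟨restrictCoords G (level j) h, Subgroup.mem_map_of_mem _ hh, ?_,
                groupSupport_restrictCoords _ _⟩⟩
            rw [← groupSupport_restrictCoords, mem_groupSupport] at hjmem
            exact fun h1 => hjmem (by rw [h1]; rfl)
          rw [hset]
          have h1 := hyF _ hmem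
          have h2 : ∑ i ∈ level j ∩ groupSupport h, (ε + σ * (y i - 1)) * u i
              = ε * ∑ i ∈ level j ∩ groupSupport h, u i
                + σ * ∑ i ∈ level j ∩ groupSupport h, (y i - 1) * u i := by
            rw [Finset.mul_sum, Finset.mul_sum, ← Finset.sum_add_distrib]
            exact Finset.sum_congr rfl fun i _ => by ring
          have h3 := neg_abs_le (σ * ∑ i ∈ level j ∩ groupSupport h, (y i - 1) * u i)
          rw [abs_mul, hσ, one_mul] at h3
          rw [h2]
          linarith)
      refine h0.trans_eq (Finset.sum_congr rfl fun i hi => ?_)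
      have := (hupos i hi).ne'
      field_simp
    have hexp : ∀ σ : ℝ, ∑ i ∈ s, (ε + σ * (y i - 1)) * W i
        = (ε - σ) * ∑ i ∈ s, W i + σ * ∑ i ∈ s, y i * W i := by
      intro σ
      rw [Finset.mul_sum, Finset.mul_sum, ← Finset.sum_add_distrib]
      exact Finset.sum_congr rfl fun i _ => by ring
    have hw' : groupWeight w h = ∑ i ∈ s, W i := by
      rw [groupWeight_eq_sum]
      simpa using hsum fun _ => 1
    have hv' : groupWeight (fun i => (y i).toNNReal * w i) h = ∑ i ∈ s, y i * W i := by
      rw [groupWeight_eq_sum, ← hsum]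
      exact Finset.sum_congr rfl fun i _ => by
        rw [NNReal.coe_mul, Real.coe_toNNReal _ (hy0 i)]
    have h1 := hkey 1 (by simp)
    have h2 := hkey (-1) (by simp)
    rw [hexp] at h1 h2
    rw [hw', hv']
    constructor <;> linarith
  · have hle : sparsifierSize (fun i => (y i).toNNReal * w i)
        ≤ (Finset.univ.filter fun i => y i ≠ 0).card := by
      rw [sparsifierSize, ← Set.ncard_coe_finset]
      refine Set.ncard_le_ncard (fun i hi => ?_) (Set.toFinite _)
      simp only [Finset.coe_filter, Finset.mem_univ, true_and]
      intro h0
      exact hi (by simp [h0])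
    refine (Nat.cast_le.2 hle).trans (hysize.trans (le_of_eq ?_))
    rw [Real.log_pow]
    push_cast
    ring

/-! ### Chains and non-redundancy -/

/-- An element with pattern `c n` vanishes at all earlier `a t` but not at `a n`, so each further
coordinate cuts the vanishing subgroup at least in half. -/
theorem two_pow_le_card_of_isCodeChain {ι G : Type*} [Finite ι] [Group G] [Finite G]
    {H : Subgroup (ι → G)} {l : ℕ} {a : Fin l → ι} {c : Fin l → ι → Bool}
    (hac : IsCodeChain (zeroPatternCode H) a c) : 2 ^ l ≤ Nat.card H := by
  have key : ∀ n ≤ l,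
      2 ^ n * Nat.card (vanishingSubgroup H {i | ∃ t : Fin l, t.1 < n ∧ a t = i}) ≤ Nat.card H := by
    intro n
    induction n with
    | zero =>
      intro _
      rw [pow_zero, one_mul]
      exact Subgroup.card_le_of_le (vanishingSubgroup_le _ _)
    | succ n ih =>
      intro hn
      have hlt : vanishingSubgroup H {i | ∃ t : Fin l, t.1 < n + 1 ∧ a t = i}
          < vanishingSubgroup H {i | ∃ t : Fin l, t.1 < n ∧ a t = i} := by
        refine lt_of_le_of_ne (vanishingSubgroup_anti H ?_) fun heq => ?_
        · rintro i ⟨t, ht, rfl⟩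
          exact ⟨t, by omega, rfl⟩
        · obtain ⟨h, hh, hc⟩ := hac.mem ⟨n, hn⟩
          have h1 : h ∈ vanishingSubgroup H {i | ∃ t : Fin l, t.1 < n ∧ a t = i} := by
            refine ⟨hh, ?_⟩
            rintro i ⟨t, ht, rfl⟩
            by_contra hne
            have := hac.above t ⟨n, hn⟩ ht
            rw [(hc _).2 hne] at this
            exact Bool.noConfusion this
          rw [← heq] at h1
          exact (hc _).1 (hac.diag ⟨n, hn⟩) (h1.2 _ ⟨⟨n, hn⟩, n.lt_succ_self, rfl⟩)
      calc _ = 2 ^ n * (2 * Nat.card (vanishingSubgroup H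
                {i | ∃ t : Fin l, t.1 < n + 1 ∧ a t = i})) := by ring
        _ ≤ _ := Nat.mul_le_mul_left _ (two_mul_card_le_of_lt hlt)
        _ ≤ _ := ih (by omega)
  exact le_trans (Nat.le_mul_of_pos_right _ Nat.card_pos) (key l le_rfl)

theorem IsNonRedundant.exists_isCodeChain {ι : Type*} {C : Set (ι → Bool)} {I : Finset ι}
    (hI : IsNonRedundant C I) : ∃ (a : Fin I.card → ι) (c : Fin I.card → ι → Bool),
      IsCodeChain C a c := by
  choose c hc hcI using fun i : I => hI i i.2
  let e := I.equivFin.symm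
  refine ⟨fun t => e t, fun t => c (e t), ⟨?_, ?_, fun t => hc _, fun t => ?_, fun s t hst => ?_⟩⟩
  · exact Subtype.val_injective.comp e.injective
  · intro s t hst
    have h1 : c (e s) (e s) = true := (hcI (e s) _ (e s).2).2 rfl
    rw [show c (e s) = c (e t) from hst] at h1
    exact e.injective (Subtype.ext ((hcI (e t) _ (e s).2).1 h1).symm)
  · exact (hcI (e t) _ (e t).2).2 rfl
  · rw [← Bool.not_eq_true]
    intro h1
    exact hst.ne' (e.injective (Subtype.ext ((hcI (e t) _ (e s).2).1 h1)))

theorem chainLength_le_logb {ι G : Type*} [Fintype ι] [Group G] [Finite G]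
    (H : Subgroup (ι → G)) :
    (chainLength (zeroPatternCode H) : ℝ) ≤ Real.logb 2 (Nat.card H) := by
  have h : chainLength (zeroPatternCode H) ≤ Nat.log 2 (Nat.card H) := by
    refine csSup_le' ?_
    rintro l ⟨a, c, hac⟩
    exact Nat.le_log_of_pow_le one_lt_two (two_pow_le_card_of_isCodeChain hac)
  exact (Nat.cast_le.2 h).trans (by exact_mod_cast Real.natLog_le_logb (Nat.card H) 2)

theorem nonRedundancy_le_logb {ι G : Type*} [Fintype ι] [Group G] [Finite G]
    (H : Subgroup (ι → G)) :
    (nonRedundancy (zeroPatternCode H) : ℝ) ≤ Real.logb 2 (Nat.card H) := by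
  have h : nonRedundancy (zeroPatternCode H) ≤ Nat.log 2 (Nat.card H) := by
    refine csSup_le' ?_
    rintro l ⟨I, hI, rfl⟩
    obtain ⟨a, c, hac⟩ := hI.exists_isCodeChain
    exact Nat.le_log_of_pow_le one_lt_two (two_pow_le_card_of_isCodeChain hac)
  exact (Nat.cast_le.2 h).trans (by exact_mod_cast Real.natLog_le_logb (Nat.card H) 2)

/-! ### The main theorem -/

theorem mainTheorem8 :
    ∃ K : ℝ, 0 < K ∧
      ∀ (G : Type*) [Group G] [Finite G] (m : ℕ) (H : Subgroup (Fin m → G)),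
        (nonRedundancy (zeroPatternCode H) : ℝ) ≤ Real.logb 2 (Nat.card H) ∧
        (chainLength (zeroPatternCode H) : ℝ) ≤ Real.logb 2 (Nat.card H) ∧
        ∀ ε : ℝ, 0 < ε → ε < 1 →
          (∃ v : Fin m → ℝ≥0, IsGroupSparsifier H ε v ∧
            (sparsifierSize v : ℝ) ≤
              K * (Real.log (Nat.card H) * Real.log (max (m : ℝ) 2) ^ 6 / ε ^ 2)) ∧
          (∀ w : Fin m → ℝ≥0, ∃ v : Fin m → ℝ≥0, IsWeightedGroupSparsifier H w ε v ∧
            (sparsifierSize v : ℝ) ≤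
              K * (Real.log (Nat.card H) * Real.log (max (m : ℝ) 2) ^ 6 / ε ^ 2)) := by
  have hl2 : 0 < Real.log 2 := Real.log_pos one_lt_two
  have hl2' : Real.log 2 < 1 := Real.log_two_lt_d9.trans (by norm_num)
  -- The powers of `log 2` pay for changing the base of the logarithm and for raising `log M` to its
  -- sixth power.
  refine ⟨240 / Real.log 2 ^ 7, by positivity, fun G _ _ m H =>
    ⟨nonRedundancy_le_logb H, chainLength_le_logb H, fun ε hε hε1 => ?_⟩⟩
  have weighted : ∀ w : Fin m → ℝ≥0, ∃ v : Fin m → ℝ≥0, IsWeightedGroupSparsifier H w ε v ∧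
      (sparsifierSize v : ℝ) ≤
        240 / Real.log 2 ^ 7 *
          (Real.log (Nat.card H) * Real.log (max (m : ℝ) 2) ^ 6 / ε ^ 2) := by
    intro w
    set M : ℝ := max (m : ℝ) 2 with hMdef
    set k := Real.logb 2 (Nat.card H) with hk
    have hk0 : 0 ≤ k := logb_card_nonneg H
    have hlogH : Real.log (Nat.card H) = k * Real.log 2 := by
      rw [hk, Real.logb, div_mul_cancel₀ _ hl2.ne']
    have hM : 2 ≤ M := le_max_right _ _
    have hlM : Real.log 2 ≤ Real.log M := Real.log_le_log two_pos hM
    have hlM5 : Real.log 2 ^ 5 ≤ Real.log M ^ 5 := pow_le_pow_left₀ hl2.le hlM 5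
    have hbound : 240 * (Real.log M * k / ε ^ 2)
        ≤ 240 / Real.log 2 ^ 7 * (Real.log (Nat.card H) * Real.log M ^ 6 / ε ^ 2) := by
      have h6 : Real.log M * Real.log 2 ^ 6 ≤ Real.log 2 * Real.log M ^ 6 := by
        have h0 : 0 ≤ Real.log 2 * Real.log M := mul_nonneg hl2.le (hl2.le.trans hlM)
        nlinarith [mul_le_mul_of_nonneg_left hlM5 h0]
      have h7 : Real.log M ≤ Real.log 2 * Real.log M ^ 6 / Real.log 2 ^ 7 := by
        rw [le_div_iff₀ (by positivity)]
        have h0 : 0 ≤ Real.log M * Real.log 2 ^ 6 :=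
          mul_nonneg (hl2.le.trans hlM) (by positivity)
        nlinarith
      have h8 : 240 / Real.log 2 ^ 7 * (Real.log (Nat.card H) * Real.log M ^ 6 / ε ^ 2)
          = 240 * ((Real.log 2 * Real.log M ^ 6 / Real.log 2 ^ 7) * k / ε ^ 2) := by
        rw [hlogH]
        ring
      rw [h8]
      gcongr
    rcases le_or_gt k M with hkM | hkM
    · rcases (bot_le : (⊥ : Subgroup (Fin m → G)) ≤ H).eq_or_lt with hbot | hbot
      · refine ⟨0, fun h hh => ?_, ?_⟩
        · rw [← hbot, Subgroup.mem_bot] at hh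
          subst hh
          simp [groupWeight]
        · simp only [sparsifierSize, Function.support_zero, Set.ncard_empty, Nat.cast_zero]
          refine le_trans ?_ hbound
          have := hl2.le.trans hlM
          positivity
      · have hk1 : 1 ≤ k := by
          have := logb_card_add_one_le_of_lt hbot
          rwa [Subgroup.card_bot, Nat.cast_one, Real.logb_one, zero_add] at this
        obtain ⟨v, hv, hvs⟩ := exists_weighted_sparsifier H w hM
          (by rw [Fintype.card_fin]; exact le_max_left _ _) hk1 hkM hε hε1
        exact ⟨v, hv, hvs.trans hbound⟩
    -- Here `m ≤ M < log₂ |H|`, so `w` itself is small enough.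
    · refine ⟨w, fun h _ => ?_, le_trans ?_ hbound⟩
      · have h0 : 0 ≤ groupWeight w h := by
          rw [groupWeight_eq_sum]
          exact Finset.sum_nonneg fun i _ => (w i).2
        constructor <;> nlinarith
      · have h1 : (sparsifierSize w : ℝ) ≤ m := by
          rw [sparsifierSize]
          refine Nat.cast_le.2 ((Set.ncard_le_ncard (Set.subset_univ _) (Set.toFinite _)).trans ?_)
          simp [Set.ncard_univ]
        have h2 : (m : ℝ) ≤ M := le_max_left _ _
        have h3 : 1 / 2 < Real.log M :=
          lt_of_lt_of_le (lt_trans (by norm_num) Real.log_two_gt_d9) hlM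
        have h4 : k * ε ^ 2 ≤ 240 * (Real.log M * k) := by
          have : ε ^ 2 ≤ 1 := by nlinarith
          nlinarith
        have h5 : k ≤ 240 * (Real.log M * k / ε ^ 2) := by
          rw [← mul_div_assoc, le_div_iff₀ (by positivity)]
          exact h4
        linarith
  refine ⟨?_, weighted⟩
  obtain ⟨v, hv, hvs⟩ := weighted fun _ => 1
  refine ⟨v, fun h hh => ?_, hvs⟩
  rw [← groupWeight_one]
  exact hv h hh
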